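/- There is an absolute constant $c>0$ such that the following holds for every integer $n\ge 2$. Let $K\subset\mathbb{R}^n$ be an origin-symmetric convex body, that is, a compact convex set with non-empty interior such that $-K=K$. For a bounded set $A\subset\mathbb{R}^n$ let $\#A$ denote the number of points of $A\cap\mathbb{Z}^n$, let $|K|$ denote the $n$-dimensional volume of $K$, let $S^{n-1}$ be the Euclidean unit sphere, and for $\xi\in S^{n-1}$ let $\xi^\perp=\{x\in\mathbb{R}^n:\langle x,\xi\rangle=0\}$. Then $$ \#K\;\le\;\max_{\xi\in S^{n-1}}\#\big(K\cap\xi^\perp\big)\cdot\max\Big\{1,\;c\,n\,|K|^{\frac{1}{n-1}}\Big\}. $$ -/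

import Mathlib

/-- The points of `ℝⁿ` all of whose coordinates are integers. -/
def integerPoints (n : ℕ) : Set (EuclideanSpace ℝ (Fin n)) :=
  {x | ∀ i, ∃ m : ℤ, x i = (m : ℝ)}

/-- The number `#A` of integer points of `A ⊆ ℝⁿ`; it is meaningful when `A ∩ ℤⁿ` is finite,
in particular for bounded `A`. -/
noncomputable def latticeCount {n : ℕ} (A : Set (EuclideanSpace ℝ (Fin n))) : ℕ :=
  (A ∩ integerPoints n).ncard

/-- The central hyperplane `ξ^⊥`. -/
def orthHyperplane {n : ℕ} (ξ : EuclideanSpace ℝ (Fin n)) : Set (EuclideanSpace ℝ (Fin n)) :=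
  {x | inner ℝ x ξ = (0 : ℝ)}

/-- A convex body in `ℝⁿ`: a compact convex set with non-empty interior. -/
structure IsConvexBody {n : ℕ} (K : Set (EuclideanSpace ℝ (Fin n))) : Prop where
  isCompact : IsCompact K
  convex : Convex ℝ K
  interior_nonempty : (interior K).Nonempty

/-- `K` is origin-symmetric: `-K = K`. -/
def IsOriginSymmetric {n : ℕ} (K : Set (EuclideanSpace ℝ (Fin n))) : Prop :=
  (fun x => -x) '' K = K

/-! Let `S` be the set of integer points of `K`. If `S` lies in a hyperplane, the factor 1 suffices.
Otherwise a nonzero integer `y` orthogonal to at least |S|/(10r) points of `S` is wanted, with r =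
80 n |K|^(1/(n-1)).

The form Σ (x·z)² over x ∈ S equals |Bz|². By polarity an ellipsoid built from `B` lies in `K`
(`vecMul_mem_of_mulVec_dotProduct_self_eq`), which bounds |det B| above and so bounds the volume of
{z : |Bz|_∞ ≤ β} below. Van der Corput's theorem (`exists_finset_sub_mem_of_lt_volume`) then gives
more than 80r integer vectors z on which the forms x·z have mean square at most r².

Most of the integers x·z therefore take only O(r) values. By Cauchy–Schwarz there are many
collisions x·z = x·w, and some difference y = z - w ≠ 0 is orthogonal to the required share of `S`
(`card_le_of_sum_sq_le`). -/

/-! ### Counting collisions of integer inner products. -/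

/-- If the linear forms `x ⬝ᵥ ·`, `x ∈ S`, are small in mean square on a large set `F` of integer
vectors, then some difference of elements of `F` is orthogonal to many elements of `S`. -/
theorem card_le_of_sum_sq_le {ι : Type*} [Fintype ι] [DecidableEq ι] (S F : Finset (ι → ℤ))
    (r : ℝ) (hr : 1 ≤ r) (hF : ∀ z ∈ F, ∑ x ∈ S, (((x ⬝ᵥ z : ℤ) : ℝ)) ^ 2 ≤ S.card * r ^ 2)
    (hN : 80 * r ≤ F.card) (M : ℕ)
    (hM : ∀ y : ι → ℤ, y ≠ 0 → (S.filter (fun x => x ⬝ᵥ y = 0)).card ≤ M) :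
    (S.card : ℝ) ≤ M * (10 * r) := by
  classical
  set T : ℕ := ⌊2 * r⌋₊ with hT
  have hT1 : (T : ℝ) ≤ 2 * r := Nat.floor_le (by linarith)
  have hT2 : 2 * r < T + 1 := Nat.lt_floor_add_one _
  set J : Finset ℤ := Finset.Icc (-(T : ℤ)) T with hJ
  have hJc : (J.card : ℝ) ≤ 5 * r := by
    have : J.card = 2 * T + 1 := by
      rw [hJ, Int.card_Icc]; omega
    rw [this]; push_cast; linarith
  set g : (ι → ℤ) × ℤ → ℕ := fun p => (F.filter (fun z => p.1 ⬝ᵥ z = p.2)).card with hg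
  -- most pairs have a small inner product
  have good : (3 / 4 : ℝ) * (S.card * F.card) ≤ ∑ p ∈ S ×ˢ J, (g p : ℝ) := by
    -- Chebyshev, pointwise: an integer outside `J` exceeds 2r in absolute value, and (2r)² is four
    -- times the mean square, so at most a quarter of the pairs are lost.
    have h1 : ∀ x ∈ S, ∀ z ∈ F, (1 : ℝ) - ((x ⬝ᵥ z : ℤ) : ℝ) ^ 2 / (4 * r ^ 2) ≤
        ∑ t ∈ J, if x ⬝ᵥ z = t then (1 : ℝ) else 0 := by
      intro x _ z _
      rw [Finset.sum_ite_eq]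
      split_ifs with h
      · have : 0 ≤ ((x ⬝ᵥ z : ℤ) : ℝ) ^ 2 / (4 * r ^ 2) := by positivity
        linarith
      · have h2 : (T : ℤ) + 1 ≤ |x ⬝ᵥ z| := by
          rw [hJ, Finset.mem_Icc, ← abs_le] at h
          omega
        have h3 : (T : ℝ) + 1 ≤ |((x ⬝ᵥ z : ℤ) : ℝ)| := by exact_mod_cast h2
        have h4 : (4 * r ^ 2) ≤ ((x ⬝ᵥ z : ℤ) : ℝ) ^ 2 := by
          rw [← sq_abs ((x ⬝ᵥ z : ℤ) : ℝ)]
          nlinarith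
        rw [sub_nonpos, le_div_iff₀ (by positivity)]
        linarith
    have h5 : ∑ p ∈ S ×ˢ J, (g p : ℝ) =
        ∑ x ∈ S, ∑ z ∈ F, ∑ t ∈ J, if x ⬝ᵥ z = t then (1 : ℝ) else 0 := by
      rw [Finset.sum_product]
      refine Finset.sum_congr rfl fun x _ => ?_
      rw [Finset.sum_comm]
      refine Finset.sum_congr rfl fun t _ => ?_
      simp [hg]
    have h6 : ∑ x ∈ S, ∑ z ∈ F, ((1 : ℝ) - ((x ⬝ᵥ z : ℤ) : ℝ) ^ 2 / (4 * r ^ 2)) ≤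
        ∑ p ∈ S ×ˢ J, (g p : ℝ) := by
      rw [h5]
      exact Finset.sum_le_sum fun x hx => Finset.sum_le_sum fun z hz => h1 x hx z hz
    refine le_trans ?_ h6
    rw [Finset.sum_comm]
    have h7 : ∀ z ∈ F, (3 / 4 : ℝ) * S.card ≤
        ∑ x ∈ S, ((1 : ℝ) - ((x ⬝ᵥ z : ℤ) : ℝ) ^ 2 / (4 * r ^ 2)) := by
      intro z hz
      rw [Finset.sum_sub_distrib, ← Finset.sum_div]
      have : (∑ x ∈ S, ((x ⬝ᵥ z : ℤ) : ℝ) ^ 2) / (4 * r ^ 2) ≤ S.card / 4 := by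
        rw [div_le_iff₀ (by positivity)]
        linarith [hF z hz]
      simp only [Finset.sum_const, nsmul_eq_mul, mul_one]
      linarith
    calc (3 / 4 : ℝ) * (S.card * F.card) = ∑ z ∈ F, (3 / 4 : ℝ) * S.card := by
          rw [Finset.sum_const, nsmul_eq_mul]; ring
      _ ≤ _ := Finset.sum_le_sum h7
  -- collisions, counted in two ways
  have coll : ∑ p ∈ S ×ˢ J, g p ^ 2 ≤ F.card * S.card + F.card ^ 2 * M := by
    calc ∑ p ∈ S ×ˢ J, g p ^ 2
        = ∑ x ∈ S, ∑ t ∈ J, ∑ z ∈ F, ∑ w ∈ F,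
            (if x ⬝ᵥ z = t then 1 else 0) * (if x ⬝ᵥ w = t then 1 else 0) := by
          rw [Finset.sum_product]
          refine Finset.sum_congr rfl fun x _ => Finset.sum_congr rfl fun t _ => ?_
          rw [← Finset.sum_mul_sum, sq, hg]
          simp
      _ ≤ ∑ x ∈ S, ∑ z ∈ F, ∑ w ∈ F, if x ⬝ᵥ (z - w) = 0 then 1 else 0 := by
          refine Finset.sum_le_sum fun x _ => ?_
          rw [Finset.sum_comm]
          refine Finset.sum_le_sum fun z _ => ?_
          rw [Finset.sum_comm]
          refine Finset.sum_le_sum fun w _ => ?_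
          simp only [ite_mul, one_mul, zero_mul]
          simp only [Finset.sum_ite_eq, dotProduct_sub, sub_eq_zero]
          by_cases h : x ⬝ᵥ z = x ⬝ᵥ w
          · simp only [h]
            split_ifs <;> simp
          · simp [h, Ne.symm h]
      _ = ∑ z ∈ F, ∑ w ∈ F, (S.filter (fun x => x ⬝ᵥ (z - w) = 0)).card := by
          rw [Finset.sum_comm]
          refine Finset.sum_congr rfl fun z _ => ?_
          rw [Finset.sum_comm]
          refine Finset.sum_congr rfl fun w _ => ?_
          simp
      _ ≤ ∑ z ∈ F, ∑ w ∈ F, ((if z = w then S.card else 0) + M) := by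
          refine Finset.sum_le_sum fun z _ => Finset.sum_le_sum fun w _ => ?_
          by_cases h : z = w
          · simp [h]
          · simpa [h] using hM (z - w) (sub_ne_zero.2 h)
      _ = F.card * S.card + F.card ^ 2 * M := by
          simp [Finset.sum_add_distrib, sq, mul_assoc]
  have cs := sq_sum_le_card_mul_sum_sq (s := S ×ˢ J) (f := fun p => (g p : ℝ))
  have coll' : ∑ p ∈ S ×ˢ J, (g p : ℝ) ^ 2 ≤ F.card * S.card + F.card ^ 2 * M := by
    exact_mod_cast coll
  rw [Finset.card_product, Nat.cast_mul] at cs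
  -- Cauchy–Schwarz yields (9/16)sN ≤ 5rs + 5rNm. Since N ≥ 80r, the diagonal term 5rs is at most
  -- sN/16, which leaves sN/2 ≤ 5rNm.
  have key : ∀ s N m q j : ℝ, 0 ≤ s → 80 * r ≤ N → 0 ≤ m → j ≤ 5 * r →
      (3 / 4 : ℝ) * (s * N) ≤ q → q ^ 2 ≤ s * j * (N * s + N ^ 2 * m) → s ≤ m * (10 * r) := by
    intro s N m q j hs0 hN hm hj hq hcs
    have hN0 : 0 < N := by linarith
    rcases hs0.eq_or_lt with rfl | hs
    · positivity
    have h1 : s * N * ((9 / 16 : ℝ) * (s * N)) ≤ s * N * (5 * r * (s + N * m)) :=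
      calc s * N * ((9 / 16 : ℝ) * (s * N)) = ((3 / 4 : ℝ) * (s * N)) ^ 2 := by ring
        _ ≤ q ^ 2 := by gcongr
        _ ≤ _ := hcs
        _ ≤ s * (5 * r) * (N * s + N ^ 2 * m) := by gcongr
        _ = _ := by ring
    have h2 := le_of_mul_le_mul_left h1 (mul_pos hs hN0)
    have h3 : s * (80 * r) ≤ s * N := by gcongr
    refine le_of_mul_le_mul_left ?_ hN0
    linarith
  refine key _ _ _ _ _ (Nat.cast_nonneg _) hN (Nat.cast_nonneg _) hJc good (cs.trans ?_)
  exact mul_le_mul_of_nonneg_left coll' (by positivity)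

/-! ### Lattice points and volume. -/

open MeasureTheory Pointwise in
/-- Van der Corput's lattice point theorem for `ℤⁿ`: a set of volume larger than `a` has more than
`a` integer differences. -/
theorem exists_finset_sub_mem_of_lt_volume {ι : Type*} [Fintype ι] [DecidableEq ι]
    (P : Set (ι → ℝ))
    (hP : MeasurableSet P) (a : ENNReal) (ha : a < volume P) :
    ∃ F : Finset (ι → ℤ), a < F.card ∧
      ∀ z ∈ F, ∃ u ∈ P, ∃ v ∈ P, (fun i => (z i : ℝ)) = u - v := by
  classical
  by_contra! hcon
  let b := Pi.basisFun ℝ ι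
  have fd := ZSpan.isAddFundamentalDomain' b (volume : Measure (ι → ℝ))
  have : Countable (Submodule.span ℤ (Set.range b)).toAddSubgroup :=
    inferInstanceAs (Countable (Submodule.span ℤ (Set.range b)))
  have hvol : volume (ZSpan.fundamentalDomain b) = 1 := by
    rw [ZSpan.fundamentalDomain_pi_basisFun, Real.volume_pi_Ico]; simp
  refine absurd ha (not_lt.2 ?_)
  rw [fd.measure_eq_tsum]
  have hmeas : ∀ g : (Submodule.span ℤ (Set.range b)).toAddSubgroup, MeasurableSet (g +ᵥ P) :=
    fun g => hP.const_vadd g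
  have h1 : ∀ g : (Submodule.span ℤ (Set.range b)).toAddSubgroup,
      volume ((g +ᵥ P) ∩ ZSpan.fundamentalDomain b) =
      ∫⁻ u in ZSpan.fundamentalDomain b, (g +ᵥ P).indicator 1 u := by
    intro g
    rw [lintegral_indicator_one (hmeas g), Measure.restrict_apply (hmeas g)]
  simp_rw [h1]
  rw [← lintegral_tsum (fun g => (measurable_one.indicator (hmeas g)).aemeasurable)]
  -- The integrand counts the lattice translates of `P` containing `u`. If more than `a` of them
  -- did, subtracting each from a fixed one `g₀` would give more than `a` integer differences.
  refine (lintegral_mono (g := fun _ => a) fun u => ?_).trans (by simp [hvol])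
  rw [ENNReal.tsum_eq_iSup_sum]
  refine iSup_le fun G => ?_
  have hcoord : ∀ g : (Submodule.span ℤ (Set.range b)).toAddSubgroup, ∃ z : ι → ℤ,
      (fun i => (z i : ℝ)) = (g : ι → ℝ) := by
    intro g
    have := (b.mem_span_iff_repr_mem ℤ (g : ι → ℝ)).1 g.2
    choose z hz using this
    exact ⟨z, funext fun i => by simpa [b] using hz i⟩
  choose ζ hζ using hcoord
  have hζinj : Function.Injective ζ := by
    intro g h hgh
    apply Subtype.ext
    rw [← hζ, ← hζ, hgh]
  set G' := G.filter (fun g => u ∈ g +ᵥ P)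
  have h2 : ∑ g ∈ G, (g +ᵥ P).indicator (1 : (ι → ℝ) → ENNReal) u = G'.card := by
    simp [G', Set.indicator_apply]
  rw [h2]
  rcases G'.eq_empty_or_nonempty with h | ⟨g₀, hg₀⟩
  · simp [h]
  by_contra! hlt
  have hinj : Function.Injective fun g => ζ g₀ - ζ g := fun g h hgh =>
    hζinj (sub_right_injective hgh)
  obtain ⟨z, hz, hz'⟩ := hcon (G'.image fun g => ζ g₀ - ζ g)
    (by rwa [Finset.card_image_of_injective _ hinj])
  obtain ⟨g, hg, rfl⟩ := Finset.mem_image.1 hz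
  obtain ⟨p, hp, hpu⟩ := Set.mem_vadd_set.1 (Finset.mem_filter.1 hg).2
  obtain ⟨p₀, hp₀, hpu₀⟩ := Set.mem_vadd_set.1 (Finset.mem_filter.1 hg₀).2
  refine hz' p hp p₀ hp₀ ?_
  have e : (g : ι → ℝ) + p = (g₀ : ι → ℝ) + p₀ := hpu.trans hpu₀.symm
  have : (fun i => (((ζ g₀ - ζ g) i : ℤ) : ℝ)) = (g₀ : ι → ℝ) - g := by
    rw [← hζ, ← hζ]; ext i; simp
  rw [this]
  rw [sub_eq_sub_iff_add_eq_add, ← e, add_comm]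

open MeasureTheory Matrix in
/-- A symmetric convex set containing the rows of an invertible integer matrix has volume at least
that of a parallelepiped spanned by `(2 / n)`-multiples of these rows. -/
theorem two_div_pow_le_volume_of_rows_mem {n : ℕ} (hn : 0 < n) (K : Set (Fin n → ℝ))
    (hK : Convex ℝ K) (hsymm : ∀ x ∈ K, -x ∈ K) (C : Matrix (Fin n) (Fin n) ℤ) (hC : C.det ≠ 0)
    (hCK : ∀ i, (fun j => (C i j : ℝ)) ∈ K) :
    ENNReal.ofReal ((2 / n : ℝ) ^ n) ≤ volume K := by
  set D : Matrix (Fin n) (Fin n) ℝ := C.map (Int.cast : ℤ → ℝ) with hD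
  have hn' : (0 : ℝ) < n := by exact_mod_cast hn
  have hdet : (1 : ℝ) ≤ |LinearMap.det (toLin' Dᵀ)| := by
    rw [LinearMap.det_toLin', det_transpose]
    have : D.det = (C.det : ℝ) := (Int.cast_det C).symm
    rw [this]
    exact_mod_cast Int.one_le_abs hC
  set Q : Set (Fin n → ℝ) := Set.Icc (fun _ => -(1 / n : ℝ)) (fun _ => (1 / n : ℝ)) with hQ
  have hvQ : volume Q = ENNReal.ofReal ((2 / n : ℝ) ^ n) := by
    rw [hQ, Real.volume_Icc_pi, Finset.prod_const, Finset.card_univ, Fintype.card_fin,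
      ← ENNReal.ofReal_pow (by rw [sub_neg_eq_add]; positivity)]
    congr 2; ring
  have hsub : toLin' Dᵀ '' Q ⊆ K := by
    rintro _ ⟨a, ha, rfl⟩
    -- An average of `n` points, each on a segment from `-D i` to `D i` because |n * a i| ≤ 1.
    have e : toLin' Dᵀ a = ∑ i, (1 / n : ℝ) • ((n * a i) • D i) := by
      ext j
      rw [toLin'_apply, mulVec, dotProduct, Finset.sum_apply]
      refine Finset.sum_congr rfl fun i _ => ?_
      simp only [transpose_apply, Pi.smul_apply, smul_eq_mul]
      field_simp
    rw [e]
    refine hK.sum_mem (fun _ _ => by positivity) (by simp [hn'.ne']) fun i _ => ?_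
    have h1 : D i ∈ K := hCK i
    have h2 := hsymm _ h1
    have ha1 : -(1 / n : ℝ) ≤ a i := ha.1 i
    have ha2 : a i ≤ 1 / n := ha.2 i
    have h3 : -1 ≤ n * a i := by
      have := mul_le_mul_of_nonneg_left ha1 hn'.le
      rwa [mul_neg, mul_one_div_cancel hn'.ne'] at this
    have h4 : n * a i ≤ 1 := by
      have := mul_le_mul_of_nonneg_left ha2 hn'.le
      rwa [mul_one_div_cancel hn'.ne'] at this
    have h5 := hK h1 h2 (a := (1 + n * a i) / 2) (b := (1 - n * a i) / 2)
      (by linarith) (by linarith) (by ring)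
    convert h5 using 1
    rw [smul_neg, ← sub_eq_add_neg, ← sub_smul]
    congr 1; ring
  calc ENNReal.ofReal ((2 / n : ℝ) ^ n) = 1 * volume Q := by rw [hvQ, one_mul]
    _ ≤ ENNReal.ofReal |LinearMap.det (toLin' Dᵀ)| * volume Q := by
        gcongr; rwa [ENNReal.one_le_ofReal]
    _ = volume (toLin' Dᵀ '' Q) := (Measure.addHaar_image_linearMap _ _ _).symm
    _ ≤ volume K := measure_mono hsub

open Matrix in
/-- Integer vectors not contained in a hyperplane contain the rows of an invertible matrix. -/
theorem exists_det_ne_zero_of_forall_exists_dotProduct_ne_zero {n : ℕ} (S : Set (Fin n → ℤ))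
    (hS : ∀ y : Fin n → ℝ, y ≠ 0 → ∃ x ∈ S, (fun i => (x i : ℝ)) ⬝ᵥ y ≠ 0) :
    ∃ C : Matrix (Fin n) (Fin n) ℤ, C.det ≠ 0 ∧ ∀ i, C i ∈ S := by
  set c : (Fin n → ℤ) → (Fin n → ℝ) := fun x i => (x i : ℝ) with hc
  have hspan : Submodule.span ℝ (c '' S) = ⊤ := by
    by_contra hne
    obtain ⟨f, hf, hle⟩ := Submodule.exists_le_ker_of_lt_top _ (lt_top_iff_ne_top.2 hne)
    have hfe : ∀ v : Fin n → ℝ, f v = v ⬝ᵥ fun i => f (Pi.single i 1) := by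
      intro v
      rw [dotProduct]
      conv_lhs => rw [pi_eq_sum_univ' v, map_sum]
      refine Finset.sum_congr rfl fun i _ => ?_
      rw [map_smul, smul_eq_mul]
    obtain ⟨x, hx, hx'⟩ := hS (fun i => f (Pi.single i 1)) (by
      intro h0
      apply hf
      ext1 v
      ext
      simpa using congrFun h0 v)
    rw [← hfe] at hx'
    exact hx' (hle (Submodule.subset_span ⟨x, hx, rfl⟩))
  obtain ⟨b, hb, hbs, hbi⟩ := exists_linearIndependent ℝ (c '' S)
  rw [hspan] at hbs
  let B := Module.Basis.mk hbi (by rw [Subtype.range_coe, hbs])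
  have : Fintype b := FiniteDimensional.fintypeBasisIndex B
  have hcard : Fintype.card b = n := by
    rw [← Module.finrank_eq_card_basis B, Module.finrank_fin_fun]
  let B' := B.reindex (Fintype.equivFinOfCardEq hcard)
  have hB' : ∀ i, B' i ∈ c '' S := by
    intro i
    apply hb
    simp [B', B]
  choose C hC hCB using hB'
  refine ⟨Matrix.of C, ?_, hC⟩
  intro h0
  have h1 : (Matrix.of C).map (Int.cast : ℤ → ℝ) = Matrix.of B' := by
    ext i j
    rw [of_apply, ← hCB]
    rfl
  have h2 := Int.cast_det (R := ℝ) (Matrix.of C)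
  rw [h0] at h2
  have h3 : (Matrix.of B').det = 0 := by rw [← h1, Int.cast_zero] at *; exact h2.symm
  have := (Matrix.linearIndependent_rows_iff_isUnit (A := Matrix.of B')).1 B'.linearIndependent
  rw [isUnit_iff_isUnit_det, h3] at this
  exact not_isUnit_zero this

/-! ### The quadratic form of a finite set and its ellipsoid. -/

open Matrix in
open scoped MatrixOrder in
/-- A finite sum of squares of linear forms is the squared length of a square matrix applied to the
variable. -/
theorem exists_mulVec_dotProduct_self_eq_sum_sq {ι κ : Type*} [Fintype ι] [DecidableEq ι]
    (S : Finset κ) (x : κ → ι → ℝ) :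
    ∃ B : Matrix ι ι ℝ, ∀ z, (B *ᵥ z) ⬝ᵥ (B *ᵥ z) = ∑ k ∈ S, (x k ⬝ᵥ z) ^ 2 := by
  set X : Matrix S ι ℝ := Matrix.of fun k => x k with hX
  obtain ⟨B, hB⟩ := CStarAlgebra.nonneg_iff_eq_star_mul_self.mp
    (posSemidef_conjTranspose_mul_self X).nonneg
  refine ⟨B, fun z => ?_⟩
  have e1 : (B *ᵥ z) ⬝ᵥ (B *ᵥ z) = z ⬝ᵥ ((Bᴴ * B) *ᵥ z) := by
    rw [← mulVec_mulVec, dotProduct_mulVec z, vecMul_conjTranspose]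
    simp
  have e2 : (X *ᵥ z) ⬝ᵥ (X *ᵥ z) = z ⬝ᵥ ((Xᴴ * X) *ᵥ z) := by
    rw [← mulVec_mulVec, dotProduct_mulVec z, vecMul_conjTranspose]
    simp
  rw [e1, ← star_eq_conjTranspose, ← hB, ← e2, ← Finset.sum_coe_sort]
  simp only [dotProduct, sq]
  rfl

open Matrix in
/-- Points of a symmetric closed convex set `K` generate an ellipsoid contained in `K`. -/
theorem vecMul_mem_of_mulVec_dotProduct_self_eq {ι κ : Type*} [Fintype ι] [DecidableEq ι]
    (K : Set (ι → ℝ)) (hK : Convex ℝ K) (hcl : IsClosed K) (hsymm : ∀ x ∈ K, -x ∈ K)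
    (S : Finset κ) (hS : S.Nonempty) (x : κ → ι → ℝ) (hx : ∀ k ∈ S, x k ∈ K) (B : Matrix ι ι ℝ)
    (hB : ∀ z, (B *ᵥ z) ⬝ᵥ (B *ᵥ z) = ∑ k ∈ S, (x k ⬝ᵥ z) ^ 2)
    (u : ι → ℝ) (hu : S.card * (u ⬝ᵥ u) ≤ 1) : u ᵥ* B ∈ K := by
  by_contra hp
  obtain ⟨f, t, hft, htp⟩ := geometric_hahn_banach_closed_point hK hcl hp
  set y : ι → ℝ := fun i => f (Pi.single i 1) with hy
  have hfe : ∀ v : ι → ℝ, f v = v ⬝ᵥ y := by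
    intro v
    rw [dotProduct]
    conv_lhs => rw [pi_eq_sum_univ' v, map_sum]
    refine Finset.sum_congr rfl fun i _ => ?_
    rw [map_smul, smul_eq_mul]
  obtain ⟨k₀, hk₀⟩ := hS
  have habs : ∀ k ∈ S, (x k ⬝ᵥ y) ^ 2 < t ^ 2 := by
    intro k hk
    have h1 := hft _ (hx k hk)
    have h2 := hft _ (hsymm _ (hx k hk))
    rw [map_neg] at h2
    rw [hfe] at h1 h2
    exact sq_lt_sq' (by linarith) h1
  have ht : 0 < t := by
    have h1 := hft _ (hx k₀ hk₀)
    have h2 := hft _ (hsymm _ (hx k₀ hk₀))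
    rw [map_neg] at h2
    linarith
  -- The separating functional `y` exceeds `t` at `u ᵥ* B`, whereas Cauchy–Schwarz and |x k · y| < t
  -- on `S` keep it at most `t`.
  have h1 : t ^ 2 < (u ⬝ᵥ (B *ᵥ y)) ^ 2 := by
    rw [hfe, ← dotProduct_mulVec] at htp
    exact pow_lt_pow_left₀ htp ht.le two_ne_zero
  have h2 : (u ⬝ᵥ (B *ᵥ y)) ^ 2 ≤ (u ⬝ᵥ u) * ((B *ᵥ y) ⬝ᵥ (B *ᵥ y)) := by
    have := Finset.sum_mul_sq_le_sq_mul_sq Finset.univ u (B *ᵥ y)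
    simpa only [dotProduct, sq] using this
  have h3 : ∑ k ∈ S, (x k ⬝ᵥ y) ^ 2 ≤ S.card * t ^ 2 := by
    rw [← nsmul_eq_mul]
    exact Finset.sum_le_card_nsmul _ _ _ fun k hk => (habs k hk).le
  have hu0 : 0 ≤ u ⬝ᵥ u := Finset.sum_nonneg fun i _ => mul_self_nonneg (u i)
  rw [hB] at h2
  have h4 : (u ⬝ᵥ u) * ∑ k ∈ S, (x k ⬝ᵥ y) ^ 2 ≤ (u ⬝ᵥ u) * (S.card * t ^ 2) := by gcongr
  have h5 : S.card * (u ⬝ᵥ u) * t ^ 2 ≤ 1 * t ^ 2 := by gcongr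
  linarith

/-! ### The slicing inequality in the nondegenerate case. -/

/-- For `V ≥ (2 / n) ^ n`, the radius `r = 80 n V ^ (1 / (n - 1))` satisfies `1 ≤ r` and
`80 r V < (2 r / n) ^ n`. -/
theorem slicing_radius_bounds {n : ℕ} (hn : 2 ≤ n) (V : ℝ) (hV : (2 / n : ℝ) ^ n ≤ V) :
    1 ≤ 80 * n * V ^ (1 / ((n : ℝ) - 1)) ∧
      80 * (80 * n * V ^ (1 / ((n : ℝ) - 1))) * V <
        (2 * (80 * n * V ^ (1 / ((n : ℝ) - 1))) / n) ^ n := by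
  have hn0 : (0 : ℝ) < n := by positivity
  have hV0 : 0 < V := lt_of_lt_of_le (by positivity) hV
  obtain ⟨k, rfl⟩ : ∃ k, n = k + 1 := ⟨n - 1, by omega⟩
  have hk : k ≠ 0 := by omega
  set w : ℝ := V ^ (1 / (((k + 1 : ℕ) : ℝ) - 1)) with hw
  have hw0 : 0 < w := Real.rpow_pos_of_pos hV0 _
  have hwV : w ^ k = V := by
    rw [hw, Nat.cast_add_one, add_sub_cancel_right, one_div, Real.rpow_inv_natCast_pow hV0.le hk]
  have h2k : ((k + 1 : ℕ) : ℝ) ≤ 2 ^ k := by exact_mod_cast Nat.lt_two_pow_self (n := k)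
  set N : ℝ := ((k + 1 : ℕ) : ℝ) with hN
  have h160 : (2 : ℝ) ^ k ≤ 160 ^ k := by gcongr; norm_num
  constructor
  · by_contra! hlt
    have h1 : w < 1 / (80 * N) := by
      rw [lt_div_iff₀ (by positivity)]; linarith
    have h2 : w ^ k < (1 / (80 * N)) ^ k := pow_lt_pow_left₀ h1 hw0.le hk
    have h3 : (1 / (80 * N)) ^ k = (2 / N) ^ k / 160 ^ k := by
      rw [← div_pow]; congr 1; field_simp; norm_num
    rw [hwV, h3] at h2
    have h4 := hV.trans_lt h2
    rw [pow_succ, lt_div_iff₀ (by positivity), mul_assoc] at h4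
    have h5 : 1 ≤ 2 / N * 160 ^ k := by
      rw [div_mul_eq_mul_div, one_le_div hn0]; linarith
    have h6 : 0 < (2 / N) ^ k := by positivity
    nlinarith
  · have e1 : 2 * (80 * N * w) / N = 160 * w := by field_simp; norm_num
    have e2 : 80 * (80 * N * w) * V = 6400 * N * w ^ (k + 1) := by rw [← hwV]; ring
    rw [e1, e2, mul_pow]
    -- Uses k ≥ 1 and N ≤ 2^k; the inequality fails for k = 0.
    have : 6400 * N < 160 ^ (k + 1) := by
      obtain ⟨j, rfl⟩ := Nat.exists_eq_succ_of_ne_zero hk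
      have h80 : (2 : ℝ) ^ j ≤ 160 ^ j := by gcongr; norm_num
      have : (0 : ℝ) < 160 ^ j := by positivity
      rw [Nat.succ_eq_add_one, pow_succ] at h2k
      rw [Nat.succ_eq_add_one, pow_succ, pow_succ]
      linarith
    gcongr

open MeasureTheory Matrix in
/-- The slicing inequality for integer points not contained in a hyperplane. -/
theorem card_le_mul_of_forall_exists_dotProduct_ne_zero {n : ℕ} (hn : 2 ≤ n)
    (K : Set (Fin n → ℝ)) (hK : Convex ℝ K) (hcl : IsClosed K) (hsymm : ∀ x ∈ K, -x ∈ K)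
    (hfin : volume K ≠ ⊤) (S : Finset (Fin n → ℤ)) (hSK : ∀ x ∈ S, (fun i => (x i : ℝ)) ∈ K)
    (hS : ∀ y : Fin n → ℝ, y ≠ 0 → ∃ x ∈ S, (fun i => (x i : ℝ)) ⬝ᵥ y ≠ 0) (M : ℕ)
    (hM : ∀ y : Fin n → ℤ, y ≠ 0 → (S.filter (fun x => x ⬝ᵥ y = 0)).card ≤ M) :
    (S.card : ℝ) ≤ M * (800 * n * (volume K).toReal ^ (1 / ((n : ℝ) - 1))) := by
  have hn0 : (0 : ℝ) < n := by positivity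
  set c : (Fin n → ℤ) → (Fin n → ℝ) := fun x i => (x i : ℝ) with hc
  obtain ⟨C, hC, hCS⟩ := exists_det_ne_zero_of_forall_exists_dotProduct_ne_zero
    (S : Set (Fin n → ℤ)) hS
  have hSne : S.Nonempty := ⟨_, hCS ⟨0, by omega⟩⟩
  have hs0 : (0 : ℝ) < S.card := by exact_mod_cast hSne.card_pos
  have hV := two_div_pow_le_volume_of_rows_mem (by omega) K hK hsymm C hC
    fun i => hSK _ (hCS i)
  rw [ENNReal.ofReal_le_iff_le_toReal hfin] at hV
  set V := (volume K).toReal with hVdef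
  have hV0 : 0 < V := lt_of_lt_of_le (by positivity) hV
  obtain ⟨hr1, hrV⟩ := slicing_radius_bounds hn V hV
  set r : ℝ := 80 * n * V ^ (1 / ((n : ℝ) - 1)) with hr
  obtain ⟨B, hB⟩ := exists_mulVec_dotProduct_self_eq_sum_sq S c
  have hdet : B.det ≠ 0 := by
    rw [Ne, ← exists_mulVec_eq_zero_iff]
    rintro ⟨y, hy, hy0⟩
    obtain ⟨x, hx, hxy⟩ := hS y hy
    have h := hB y
    rw [hy0, dotProduct_zero, eq_comm, Finset.sum_eq_zero_iff_of_nonneg fun _ _ => sq_nonneg _] at h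
    exact hxy (pow_eq_zero_iff two_ne_zero |>.1 (h x hx))
  have hcube : ∀ a : ℝ, 0 ≤ a → volume (Set.Icc (fun _ : Fin n => -a) (fun _ => a)) =
      ENNReal.ofReal ((2 * a) ^ n) := by
    intro a ha
    rw [Real.volume_Icc_pi, Finset.prod_const, Finset.card_univ, Fintype.card_fin,
      ← ENNReal.ofReal_pow (by linarith)]
    congr 2; ring
  have hdot : ∀ (a : ℝ) (u : Fin n → ℝ), (∀ i, |u i| ≤ a) → u ⬝ᵥ u ≤ n * a ^ 2 := by
    intro a u hu
    calc u ⬝ᵥ u ≤ ∑ _i : Fin n, a ^ 2 := Finset.sum_le_sum fun i _ => by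
          rw [← sq, ← sq_abs]; gcongr; exact hu i
      _ = n * a ^ 2 := by simp
  -- an inscribed parallelepiped
  set α : ℝ := (√(n * S.card))⁻¹ with hα
  have hα0 : 0 < α := by positivity
  have hα2 : α ^ 2 = (n * S.card : ℝ)⁻¹ := by
    rw [hα, inv_pow, Real.sq_sqrt (by positivity)]
  have hin : |B.det| * (2 * α) ^ n ≤ V := by
    have hsub : toLin' Bᵀ '' Set.Icc (fun _ : Fin n => -α) (fun _ => α) ⊆ K := by
      rintro _ ⟨u, hu, rfl⟩
      rw [toLin'_apply, mulVec_transpose]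
      refine vecMul_mem_of_mulVec_dotProduct_self_eq K hK hcl hsymm S hSne c hSK B hB u ?_
      have h1 := hdot α u fun i => abs_le.2 ⟨hu.1 i, hu.2 i⟩
      calc S.card * (u ⬝ᵥ u) ≤ S.card * (n * α ^ 2) := by gcongr
        _ = 1 := by rw [hα2]; field_simp
    have h2 := measure_mono (μ := volume) hsub
    rw [Measure.addHaar_image_linearMap, hcube α hα0.le, LinearMap.det_toLin', det_transpose,
      ← ENNReal.ofReal_mul (abs_nonneg _), ENNReal.ofReal_le_iff_le_toReal hfin] at h2
    exact h2
  -- its dual, which contains many integer points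
  set β : ℝ := r / 2 * (S.card * α) with hβ
  have hβ0 : 0 < β := by positivity
  set P : Set (Fin n → ℝ) := toLin' B ⁻¹' Set.Icc (fun _ : Fin n => -β) (fun _ => β) with hP
  have hPm : MeasurableSet P :=
    measurableSet_Icc.preimage (LinearMap.continuous_of_finiteDimensional _).measurable
  have hPv : ENNReal.ofReal (80 * r) < volume P := by
    rw [hP, Measure.addHaar_preimage_linearMap _ (by rwa [LinearMap.det_toLin']), hcube β hβ0.le,
      LinearMap.det_toLin', ← ENNReal.ofReal_mul (abs_nonneg _), abs_inv,
      ENNReal.ofReal_lt_ofReal_iff_of_nonneg (by linarith)]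
    have hd : 0 < |B.det| := abs_pos.2 hdet
    rw [inv_mul_eq_div, lt_div_iff₀ hd]
    have e : 2 * r / n = (2 * β) * (2 * α) := by
      have : (2 * β) * (2 * α) = 2 * r * S.card * α ^ 2 := by rw [hβ]; ring
      rw [this, hα2]; field_simp
    rw [e, mul_pow] at hrV
    refine lt_of_mul_lt_mul_right (lt_of_le_of_lt ?_ hrV) (by positivity : (0 : ℝ) ≤ (2 * α) ^ n)
    rw [mul_assoc]
    gcongr
  obtain ⟨F, hFc, hF⟩ := exists_finset_sub_mem_of_lt_volume P hPm _ hPv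
  have hFN : 80 * r ≤ F.card := by
    rw [← ENNReal.ofReal_natCast, ENNReal.ofReal_lt_ofReal_iff_of_nonneg (by linarith)] at hFc
    exact hFc.le
  have := card_le_of_sum_sq_le S F r hr1 ?_ hFN M hM
  · calc (S.card : ℝ) ≤ M * (10 * r) := this
      _ = _ := by rw [hr]; ring
  intro z hz
  obtain ⟨u, hu, v, hv, huv⟩ := hF z hz
  have h1 : ∑ x ∈ S, (((x ⬝ᵥ z : ℤ) : ℝ)) ^ 2 = (B *ᵥ c z) ⬝ᵥ (B *ᵥ c z) := by
    rw [hB]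
    refine Finset.sum_congr rfl fun x _ => ?_
    simp [hc, dotProduct]
  rw [h1]
  have h2 := hdot (2 * β) (B *ᵥ c z) fun i => by
    have e : c z = u - v := huv
    rw [e, mulVec_sub, Pi.sub_apply, abs_le]
    have a1 : -β ≤ (B *ᵥ u) i := hu.1 i
    have a2 : (B *ᵥ u) i ≤ β := hu.2 i
    have a3 : -β ≤ (B *ᵥ v) i := hv.1 i
    have a4 : (B *ᵥ v) i ≤ β := hv.2 i
    constructor <;> linarith
  refine h2.trans (le_of_eq ?_)
  have : n * (2 * β) ^ 2 = n * r ^ 2 * S.card ^ 2 * α ^ 2 := by rw [hβ]; ring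
  rw [this, hα2]; field_simp

/-! ### Transfer to Euclidean space and the final dichotomy. -/

/-- The integer points of a bounded set are finite in number. -/
theorem finite_setOf_intCast_mem {ι : Type*} [Fintype ι] [DecidableEq ι] (K : Set (ι → ℝ))
    (hK : Bornology.IsBounded K) : {x : ι → ℤ | (fun i => (x i : ℝ)) ∈ K}.Finite := by
  obtain ⟨R, hR⟩ := hK.exists_norm_le
  refine (Set.finite_Icc (fun _ : ι => -⌈R⌉) (fun _ => ⌈R⌉)).subset fun x hx => ?_
  have h : ∀ i, |x i| ≤ ⌈R⌉ := by
    intro i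
    have h1 : |(x i : ℝ)| ≤ R := (norm_le_pi_norm (fun i => (x i : ℝ)) i).trans (hR _ hx)
    exact_mod_cast h1.trans (Int.le_ceil R)
  exact ⟨fun i => (abs_le.1 (h i)).1, fun i => (abs_le.1 (h i)).2⟩

open MeasureTheory Matrix in
theorem mainTheorem3 :
    ∃ c : ℝ, 0 < c ∧ ∀ n : ℕ, 2 ≤ n → ∀ K : Set (EuclideanSpace ℝ (Fin n)),
      IsConvexBody K → IsOriginSymmetric K →
        (K ∩ integerPoints n).Finite ∧
        ∃ M : ℕ,
          IsGreatest ((fun ξ => latticeCount (K ∩ orthHyperplane ξ)) ''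
            Metric.sphere (0 : EuclideanSpace ℝ (Fin n)) 1) M ∧
          (latticeCount K : ℝ) ≤
            (M : ℝ) * max 1 (c * (n : ℝ) *
              (MeasureTheory.volume K).toReal ^ (1 / ((n : ℝ) - 1))) := by
  -- 800 = 10 · 80: the loss 10r in the collision count with r = 80 n |K|^(1/(n-1)).
  refine ⟨800, by norm_num, fun n hn K hK hsymm => ?_⟩
  have : NeZero n := ⟨by omega⟩
  set K' : Set (Fin n → ℝ) := (WithLp.toLp 2) ⁻¹' K with hK'
  have hK'comp : IsCompact K' :=
    (PiLp.continuousLinearEquiv 2 ℝ (fun _ : Fin n => ℝ)).symm.toHomeomorph.isCompact_preimage.2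
      hK.isCompact
  have hK'conv : Convex ℝ K' :=
    hK.convex.linear_preimage (WithLp.linearEquiv 2 ℝ (Fin n → ℝ)).symm.toLinearMap
  have hK'symm : ∀ x ∈ K', -x ∈ K' := by
    intro x hx
    change WithLp.toLp 2 (-x) ∈ K
    rw [← show (fun x => -x) '' K = K from hsymm, WithLp.toLp_neg]
    exact ⟨_, hx, rfl⟩
  have hvol : volume K' = volume K :=
    (PiLp.volume_preserving_toLp (Fin n)).measure_preimage
      hK.isCompact.isClosed.measurableSet.nullMeasurableSet
  set c : (Fin n → ℤ) → EuclideanSpace ℝ (Fin n) := fun x => WithLp.toLp 2 fun i => (x i : ℝ)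
    with hc
  have hcinj : Function.Injective c := by
    intro x y h
    ext i
    exact Int.cast_injective (α := ℝ) (congrArg (fun v : EuclideanSpace ℝ (Fin n) => v i) h)
  have hcr : integerPoints n = Set.range c := by
    ext v
    constructor
    · intro hv
      choose x hx using hv
      exact ⟨x, by ext i; exact (hx i).symm⟩
    · rintro ⟨x, rfl⟩ i
      exact ⟨x i, rfl⟩
  have hSfin := finite_setOf_intCast_mem K' hK'comp.isBounded
  set S : Finset (Fin n → ℤ) := hSfin.toFinset with hSdef
  have hS : ∀ x, x ∈ S ↔ c x ∈ K := fun x => hSfin.mem_toFinset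
  have hcard : ∀ A : Set (EuclideanSpace ℝ (Fin n)), ∀ [DecidablePred fun x => c x ∈ A],
      (K ∩ A) ∩ integerPoints n = ↑((S.filter fun x => c x ∈ A).map ⟨c, hcinj⟩) := by
    intro A _
    ext v
    rw [hcr]
    simp only [Finset.coe_map, Finset.coe_filter, Function.Embedding.coeFn_mk, hS]
    constructor
    · rintro ⟨⟨h1, h2⟩, x, rfl⟩
      exact ⟨x, ⟨h1, h2⟩, rfl⟩
    · rintro ⟨x, ⟨h1, h2⟩, rfl⟩
      exact ⟨⟨h1, h2⟩, x, rfl⟩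
  classical
  have hKS : K ∩ integerPoints n = ↑(S.map ⟨c, hcinj⟩) := by
    have := hcard Set.univ
    simpa using this
  have hcount : ∀ ξ, latticeCount (K ∩ orthHyperplane ξ) =
      (S.filter fun x => (fun i => (x i : ℝ)) ⬝ᵥ ξ.ofLp = 0).card := by
    intro ξ
    rw [latticeCount, hcard, Set.ncard_coe_finset, Finset.card_map]
    congr 1
    refine Finset.filter_congr fun x _ => ?_
    simp only [orthHyperplane, Set.mem_ofPred_eq, hc, EuclideanSpace.inner_eq_star_dotProduct]
    rw [dotProduct_comm]
    simp
  have hcountK : latticeCount K = S.card := by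
    rw [latticeCount, hKS, Set.ncard_coe_finset, Finset.card_map]
  refine ⟨hKS ▸ Finset.finite_toSet _, ?_⟩
  set V : Set ℕ := (fun ξ => latticeCount (K ∩ orthHyperplane ξ)) ''
    Metric.sphere (0 : EuclideanSpace ℝ (Fin n)) 1 with hV
  have hVne : V.Nonempty := (NormedSpace.sphere_nonempty.2 zero_le_one).image _
  have hVbdd : BddAbove V := by
    refine ⟨S.card, ?_⟩
    rintro _ ⟨ξ, -, rfl⟩
    simpa only [hcount] using Finset.card_filter_le _ _
  refine ⟨sSup V, ⟨Nat.sSup_mem hVne hVbdd, fun m hm => le_csSup hVbdd hm⟩, ?_⟩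
  have hM : ∀ y : Fin n → ℝ, y ≠ 0 →
      (S.filter fun x => (fun i => (x i : ℝ)) ⬝ᵥ y = 0).card ≤ sSup V := by
    intro y hy
    set w : EuclideanSpace ℝ (Fin n) := WithLp.toLp 2 y with hw
    have hw0 : ‖w‖ ≠ 0 := by
      rw [norm_ne_zero_iff]
      intro h
      exact hy (by simpa [hw] using h)
    refine le_csSup hVbdd ⟨‖w‖⁻¹ • w, ?_, ?_⟩
    · rw [mem_sphere_zero_iff_norm, norm_smul, norm_inv, norm_norm, inv_mul_cancel₀ hw0]
    · simp only [hcount]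
      congr 1
      refine Finset.filter_congr fun x _ => ?_
      rw [WithLp.ofLp_smul, dotProduct_smul, smul_eq_mul, mul_eq_zero, or_iff_right (inv_ne_zero hw0)]
  rw [hcountK]
  -- Without a spanning set of integer points `|K|` may be arbitrarily small; one central section
  -- then contains all of `S`, and the 1 in the maximum is what is used.
  by_cases hnd : ∀ y : Fin n → ℝ, y ≠ 0 → ∃ x ∈ S, (fun i => (x i : ℝ)) ⬝ᵥ y ≠ 0
  · refine (card_le_mul_of_forall_exists_dotProduct_ne_zero hn K' hK'conv hK'comp.isClosed hK'symm
      hK'comp.measure_lt_top.ne S (fun x hx => (hS x).1 hx) hnd (sSup V) fun y hy => ?_).trans ?_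
    · convert hM (fun i => (y i : ℝ)) ?_ using 4 with x
      · rw [← Int.cast_inj (α := ℝ)]
        simp [dotProduct]
      · intro h
        apply hy
        ext i
        exact Int.cast_eq_zero.1 (congrFun h i)
    · rw [hvol]
      gcongr
      exact le_max_right _ _
  · push Not at hnd
    obtain ⟨y, hy, hy0⟩ := hnd
    have h := hM y hy
    rw [Finset.filter_true_of_mem hy0] at h
    calc (S.card : ℝ) ≤ (sSup V : ℕ) := by exact_mod_cast h
      _ ≤ _ := le_mul_of_one_le_right (Nat.cast_nonneg _) (le_max_left _ _)
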